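/- Let $q=4m+3$ be a prime and let $g$ be a primitive root modulo both $q$ and $2q$. For $i\in\{0,1\}$ put $D_i^{(2q)}=\{g^{2s+i} : 0\le s<\frac{q-1}{2}\}\subset\mathbb{Z}_{2q}$. Let $r$ be a prime with $r \bmod 2q\in D_0^{(2q)}$, let $\ell=\mathrm{ord}_{2q}(r)$ be its multiplicative order modulo $2q$, and let $\theta=\frac{q-1}{2\ell}$. The field $\mathbb{F}_{r^{\ell}}$ contains a primitive $2q$-th root of unity. For every such root $\eta$ and each $i\in\{0,1\}$, the polynomial $g_{D_i}(x)=\prod_{j\in D_i^{(2q)}}(x-\eta^j)$ lies in $\mathbb{F}_r[x]$ and divides $x^{2q}-1$, and the cyclic code $C_{D_i}=\langle g_{D_i}(x)\rangle\subseteq\mathbb{F}_r^{2q}$ contains its Euclidean dual. Moreover, for every integer $z$ with $0\le z\le\theta-2$ there are monic polynomials $g',g''\in\mathbb{F}_r[x]$ with $g''\mid g'\mid g_{D_i}$ such that the cyclic codes $C'=\langle g'\rangle$ and $C''=\langle g''\rangle$ of length $2q$ satisfy $$C_{D_i}\subseteq C'\subsetneq C''\subsetneq\mathbb{F}_r^{2q},\qquad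 C'^{\perp}\subseteq C',\qquad \dim C'=\tfrac{3q+1}{2}+z\ell ,$$ the quotient $f=g'/g''$ has order $2q$ (the least $e\ge1$ with $f\mid x^{e}-1$ is $e=2q$, the largest value possible for a divisor of $x^{2q}-1$), and the following holds. For all integers $c_l,c_r\ge0$ with $c_l+c_r<2q$ there is a quantum synchronizable code with parameters $$(c_l,c_r)\text{-}[[\,2q+c_l+c_r,\;q+2z\ell+1\,]]_r$$ which corrects up to $\lfloor (d''-1)/2\rfloor$ bit errors and up to $\lfloor (d'-1)/2\rfloor$ phase errors, where $d',d''$ are the minimum distances of $C',C''$. Here a quantum synchronizable code with parameters $(c_l,c_r)\text{-}[[N,k]]_r$ correcting $t_b$ bit errors and $t_p$ phase errors is a subspace $Q\subseteq(\mathbb{C}^r)^{\otimes N}$ of dimension $r^k$ with two properties. (1) There is a quantum channel that restores every state of $Q$ after every generalized Pauli error $X^eZ^p$, $e,p\in\mathbb{F}_r^N$, with $\mathrm{wt}(e)\le t_b$ and $\mathrm{wt}(p)\le t_p$. (2) There is a projective measurement of $N$ qudits with the following property. Take any stream of consecutive blocks in states of $Q$, corrupted by a generalized Pauli error with at most $t_b$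 bit errors and $t_p$ phase errors in each block. Whenever the measurement is applied to $N$ consecutive qudits of the stream that start $a$ positions to the right of a block boundary, $-c_l\le a\le c_r$ (to the left if $a<0$), its outcome is $a$ with certainty and the state of the stream is not disturbed. -/

import Mathlib

open Polynomial

noncomputable section

/-- The cyclotomic class `D_i` of order two in `ℤ/2q`, for a primitive root `g` modulo `2q`:
`D_i = {g^(2s+i) | 0 ≤ s < (q-1)/2}`. -/
def cyclotomicClassD (q g i : ℕ) : Finset (ZMod (2 * q)) :=
  (Finset.range ((q - 1) / 2)).image fun s => (g : ZMod (2 * q)) ^ (2 * s + i)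

/-- The polynomial `∏_{j ∈ D} (x - η^j)`, where `η` is a `2q`-th root of unity. -/
def classPoly {K : Type*} [Field K] {q : ℕ} (η : K) (D : Finset (ZMod (2 * q))) : K[X] :=
  ∏ j ∈ D, (X - C (η ^ j.val))

/-- The cyclic code `⟨g⟩` of length `n`, for a divisor `g` of `x^n - 1`: all words
`(c_0, …, c_{n-1})` such that `g` divides `c_0 + c_1 x + ⋯ + c_{n-1} x^{n-1}`. -/
def cyclicCode {F : Type*} [Field F] (n : ℕ) (g : F[X]) : Submodule F (Fin n → F) where
  carrier := {c | g ∣ ∑ i : Fin n, C (c i) * X ^ (i : ℕ)}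
  zero_mem' := by simp
  add_mem' := by
    intro a b ha hb
    simpa [add_mul, Finset.sum_add_distrib] using dvd_add ha hb
  smul_mem' := by
    intro a c hc
    simpa [mul_assoc, Finset.mul_sum] using Dvd.dvd.mul_left hc (C a)

/-- The Euclidean dual code. -/
def dualCode {F : Type*} [Field F] {n : ℕ} (D : Submodule F (Fin n → F)) :
    Submodule F (Fin n → F) where
  carrier := {x | ∀ c ∈ D, x ⬝ᵥ c = 0}
  zero_mem' := by simp
  add_mem' := by
    intro a b ha hb c hc
    simp [add_dotProduct, ha c hc, hb c hc]
  smul_mem' := by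
    intro a x hx c hc
    simp [smul_dotProduct, hx c hc]

/-- The minimum distance of a (nonzero) linear code: the least weight of a nonzero codeword. -/
def minDist {F : Type*} [Field F] [DecidableEq F] {n : ℕ} (D : Submodule F (Fin n → F)) : ℕ :=
  sInf {w | ∃ c ∈ D, c ≠ 0 ∧ hammingNorm c = w}

/-- `ord(f) = e`: `e` is the least positive integer with `f ∣ x^e - 1`. -/
def HasPolyOrder {F : Type*} [Field F] (f : F[X]) (e : ℕ) : Prop :=
  IsLeast {k : ℕ | 0 < k ∧ f ∣ X ^ k - 1} e

/-- State vectors of a register of `r`-level systems (qudits) with positions in `ι`, written in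
the computational basis `|w⟩`, `w : ι → ZMod r`. The inner product is `star φ ⬝ᵥ ψ`. -/
abbrev QState (r : ℕ) (ι : Type) : Type := (ι → ZMod r) → ℂ

/-- Operators on a register of qudits, as matrices in the computational basis. -/
abbrev QOp (r : ℕ) (ι : Type) : Type := Matrix (ι → ZMod r) (ι → ZMod r) ℂ

/-- The generalized Pauli error `X^e Z^p : |u⟩ ↦ ω^(p·u) |u + e⟩`, `ω = exp(2πi/r)`.
It has a bit error at each position where `e ≠ 0`, a phase error at each one where `p ≠ 0`. -/
def pauli {r : ℕ} [NeZero r] {ι : Type} [Fintype ι] (e p : ι → ZMod r) (ψ : QState r ι) :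
    QState r ι :=
  fun w => ZMod.stdAddChar (p ⬝ᵥ (w - e)) * ψ (w - e)

/-- The operator `P ⊗ 1` on a register with positions `κ`, where `P` acts on the qudits at the
positions `pos i`, `i : ι` (with `pos` injective). -/
def applyAt {r : ℕ} [NeZero r] {ι κ : Type} [Fintype ι] [DecidableEq ι] (pos : ι → κ)
    (P : QOp r ι) (Ψ : QState r κ) : QState r κ :=
  fun w => ∑ u : ι → ZMod r, P (fun i => w (pos i)) u * Ψ (Function.extend pos u w)

/-- The position in a stream of `T` blocks of length `N` of the `i`-th qudit of block `b`;
it is the number `i + N * b`. -/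
def blockPos {T N : ℕ} (b : Fin T) (i : Fin N) : Fin (T * N) := finProdFinEquiv (b, i)

/-- The `N` consecutive positions `s, s + 1, …, s + N - 1` of a stream. -/
def windowPos {L N : ℕ} (s : ℕ) (h : s + N ≤ L) (i : Fin N) : Fin L :=
  ⟨s + i, by omega⟩

/-- The product state `ψ_0 ⊗ ψ_1 ⊗ ⋯ ⊗ ψ_{T-1}` of a stream of `T` blocks. -/
def streamState {r T N : ℕ} (ψ : Fin T → QState r (Fin N)) : QState r (Fin (T * N)) :=
  fun w => ∏ b : Fin T, ψ b fun i => w (blockPos b i)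

/-- `Q` corrects up to `tb` bit errors and up to `tp` phase errors: there is a quantum channel,
given by Kraus operators, that restores every state of `Q` after every such error. -/
def CorrectsErrors {r N : ℕ} [NeZero r] (tb tp : ℕ) (Q : Submodule ℂ (QState r (Fin N))) : Prop :=
  ∃ (M : ℕ) (R : Fin M → QOp r (Fin N)),
    ∑ k, (R k).conjTranspose * R k = 1 ∧
    ∀ e p : Fin N → ZMod r, hammingNorm e ≤ tb → hammingNorm p ≤ tp →
      ∀ k, ∃ c : ℂ, ∀ ψ ∈ Q, (R k).mulVec (pauli e p ψ) = c • ψ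

/-- `Q` corrects misalignment by up to `cl` qudits to the left and up to `cr` to the right, in the
presence of up to `tb` bit errors and `tp` phase errors in each block: there is a projective
measurement of `N` qudits such that, if it is applied to `N` consecutive qudits of a stream of
(corrupted) blocks of `Q` which start `a` positions to the right of a block boundary
(`-cl ≤ a ≤ cr`, negative meaning to the left), then the outcome is `a` with certainty and the
state of the stream is not disturbed. So the receiver can move to the right boundary. -/
def CorrectsMisalignment {r N : ℕ} [NeZero r] (cl cr tb tp : ℕ)
    (Q : Submodule ℂ (QState r (Fin N))) : Prop :=
  ∃ P : ℤ → QOp r (Fin N),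
    (∀ a, IsStarProjection (P a)) ∧ (∀ a a', a ≠ a' → P a * P a' = 0) ∧
    ∀ a : ℤ, -(cl : ℤ) ≤ a → a ≤ (cr : ℤ) →
    ∀ (T : ℕ) (b : Fin T) (s : ℕ) (h : s + N ≤ T * N), (s : ℤ) = (b : ℕ) * N + a →
    ∀ ψ : Fin T → QState r (Fin N), (∀ j, ψ j ∈ Q) →
    ∀ e p : Fin (T * N) → ZMod r,
      (∀ j : Fin T, hammingNorm (fun i : Fin N => e (blockPos j i)) ≤ tb) →
      (∀ j : Fin T, hammingNorm (fun i : Fin N => p (blockPos j i)) ≤ tp) →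
      applyAt (windowPos s h) (P a) (pauli e p (streamState ψ)) = pauli e p (streamState ψ)

/-- `Q` is a quantum synchronizable code with parameters `(cl, cr)-[[N, k]]_r` that corrects up to
`tb` bit errors and `tp` phase errors: it encodes `k` logical qudits into `N` physical ones, and
corrects misalignment by up to `cl` qudits to the left and `cr` to the right, and such errors. -/
structure IsQuantumSynchronizable {r N : ℕ} [NeZero r] (cl cr k tb tp : ℕ)
    (Q : Submodule ℂ (QState r (Fin N))) : Prop where
  dim : Module.finrank ℂ Q = r ^ k
  misalignment : CorrectsMisalignment cl cr tb tp Q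
  errors : CorrectsErrors tb tp Q

end

/-!
The zeros of the generators are powers `η ^ j` of a primitive `2q`-th root of unity, with exponents
`j` in a cyclotomic class `D_i`. As `r` is a square modulo `2q`, the class is stable under
multiplication by `r`; it contains the `θ` disjoint orbits of the powers of `r` through `g^(2t+i)`,
`t < θ`, each with `l` elements (`card_powCosets`), and a product over a union of orbits is fixed by
Frobenius, so it has coefficients in the prime field (`exists_map_eq_classPoly`). As `q ≡ 3 mod 4`,
`-1` is not a square, so a zero and its inverse are never both zeros of the generator
(`neg_notMem_cyclotomicClassD`); hence the codes contain their duals: if `x` is orthogonal to all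
cyclic shifts of `c` then `x(ζ⁻¹) c(ζ) = 0` for every root of unity `ζ`, and one takes for `c` the
generator (`dualCode_le_cyclicCode`). The generators `g'` and `g''` are the products over `θ - z`
and over `θ - z - 1` orbits, so that `f = g' / g''` is the product over a single orbit. All its
zeros are primitive `2q`-th roots of unity, and it has order `2q`.

The quantum code (`exists_isQuantumSynchronizable`) consists of the coset states of the
dual-containing code `C' = ⟨g'⟩`, shifted by the word of `g''` and continued periodically to length
`2q + cl + cr`. Bit errors are identified by decoding in `C'' = ⟨g''⟩`. Phase errors act through
their sums over the copies of each letter; two of them have orthogonal images unless the sums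
differ by a word of `(C'^⊥)^⊥ = C'`. Errors with orthogonal images are corrected by an explicit
channel (`exists_recovery`). For the synchronization, the `2q` letters of a misaligned window that
start `cl` positions after its beginning always lie inside a single block and form a cyclic shift
of a word of `g'' + C'`, up to bit errors. After decoding in `C''`, the shift `t` can be read off
because `x^t g'' ≡ x^t' g''` modulo `g' = f g''` only if `f ∣ x^|t - t'| - 1`
(`eq_of_cyclicShift_eq`), which is impossible for `0 < |t - t'| < 2q`. The measurement is diagonal
in the computational basis, so that phases play no role for it.
-/

/-! ### Linear codes and their Euclidean duals -/

section LinearCodes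

variable {F : Type*} [Field F] {n : ℕ}

lemma nondegenerate_dotProductBilin :
    (dotProductBilin F F : LinearMap.BilinForm F (Fin n → F)).Nondegenerate := by
  refine ⟨fun x hx => ?_, fun x hx => ?_⟩
  · funext i
    simpa using hx (Pi.single i 1)
  · funext i
    simpa using hx (Pi.single i 1)

lemma dualCode_eq_orthogonal (D : Submodule F (Fin n → F)) :
    dualCode D =
      LinearMap.BilinForm.orthogonal
        (dotProductBilin F F : LinearMap.BilinForm F (Fin n → F)) D := by
  ext x
  change (∀ c ∈ D, x ⬝ᵥ c = 0) ↔ ∀ c ∈ D, c ⬝ᵥ x = 0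
  simp only [dotProduct_comm]

lemma finrank_dualCode (D : Submodule F (Fin n → F)) :
    Module.finrank F (dualCode D) = n - Module.finrank F D := by
  rw [dualCode_eq_orthogonal,
    LinearMap.BilinForm.finrank_orthogonal nondegenerate_dotProductBilin, Module.finrank_fin_fun]

lemma dualCode_dualCode (D : Submodule F (Fin n → F)) : dualCode (dualCode D) = D := by
  rw [dualCode_eq_orthogonal, dualCode_eq_orthogonal,
    LinearMap.BilinForm.orthogonal_orthogonal nondegenerate_dotProductBilin]
  intro x y h
  change y ⬝ᵥ x = 0
  rw [dotProduct_comm]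
  exact h

lemma eq_zero_of_hammingNorm_lt_minDist [DecidableEq F] {D : Submodule F (Fin n → F)}
    {c : Fin n → F} (hc : c ∈ D) (h : hammingNorm c < minDist D) : c = 0 := by
  by_contra hne
  exact Nat.notMem_of_lt_sInf h ⟨c, hc, hne, rfl⟩

/-- Two words of a code whose difference is also a difference of two vectors of weight at most
`(d - 1) / 2` coincide. If `d = 0` the bound still gives weight zero. -/
lemma eq_of_sub_eq_sub_of_hammingNorm_le [DecidableEq F] {D : Submodule F (Fin n → F)}
    {c c' e e' : Fin n → F} (hc : c ∈ D) (hc' : c' ∈ D)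
    (he : hammingNorm e ≤ (minDist D - 1) / 2) (he' : hammingNorm e' ≤ (minDist D - 1) / 2)
    (h : c - c' = e' - e) : c = c' := by
  rcases Nat.eq_zero_or_pos (minDist D) with h0 | hpos
  · have h1 : e = 0 := by
      rw [← hammingNorm_eq_zero]
      omega
    have h2 : e' = 0 := by
      rw [← hammingNorm_eq_zero]
      omega
    rw [h1, h2, sub_zero] at h
    exact sub_eq_zero.1 h
  · refine sub_eq_zero.1 (eq_zero_of_hammingNorm_lt_minDist (D.sub_mem hc hc') ?_)
    have : hammingNorm (e' - e) ≤ hammingNorm e' + hammingNorm e := by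
      have := hammingDist_triangle e 0 e'
      rwa [hammingDist_eq_hammingNorm, hammingDist_zero_right, hammingDist_zero_left,
        neg_add_eq_sub, add_comm] at this
    rw [h]
    omega

end LinearCodes

/-! ### Cyclic codes -/

section CyclicCodes

variable {F : Type*} [Field F] {n : ℕ}

/-- The polynomial `c_0 + c_1 x + ⋯ + c_{n-1} x^{n-1}` of a word. -/
noncomputable def wordPoly (n : ℕ) : (Fin n → F) →ₗ[F] F[X] where
  toFun c := ∑ i : Fin n, C (c i) * X ^ (i : ℕ)
  map_add' a b := by simp [add_mul, Finset.sum_add_distrib]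
  map_smul' a c := by simp [smul_eq_C_mul, mul_assoc, Finset.mul_sum]

lemma wordPoly_apply (c : Fin n → F) :
    wordPoly n c = ∑ i : Fin n, C (c i) * X ^ (i : ℕ) := rfl

lemma mem_cyclicCode {g : F[X]} {c : Fin n → F} : c ∈ cyclicCode n g ↔ g ∣ wordPoly n c := Iff.rfl

/-- The word of length `n` of the coefficients of a polynomial. -/
noncomputable def polyWord (n : ℕ) (p : F[X]) : Fin n → F := fun i => p.coeff i

lemma wordPoly_polyWord {p : F[X]} (hp : p.natDegree < n) : wordPoly n (polyWord n p) = p := by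
  simp only [wordPoly_apply, polyWord]
  rw [Fin.sum_univ_eq_sum_range (fun i => C (p.coeff i) * X ^ i) n]
  simp only [C_mul_X_pow_eq_monomial]
  exact (p.as_sum_range' n hp).symm

lemma cyclicCode_anti {g h : F[X]} (hd : h ∣ g) : cyclicCode n g ≤ cyclicCode n h :=
  fun _ hc => hd.trans hc

/-- The map from words to `F[x]/(g)` is onto with kernel the cyclic code, which therefore has
codimension `deg g`. -/
lemma finrank_cyclicCode {g : F[X]} (hg : g.Monic) (hn : g.natDegree ≤ n) :
    Module.finrank F (cyclicCode n g) + g.natDegree = n := by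
  let φ : (Fin n → F) →ₗ[F] AdjoinRoot g := (AdjoinRoot.mkₐ g).toLinearMap ∘ₗ wordPoly n
  have hker : LinearMap.ker φ = cyclicCode n g := by
    ext c
    rw [LinearMap.mem_ker, mem_cyclicCode]
    exact AdjoinRoot.mk_eq_zero
  have hsurj : Function.Surjective φ := by
    intro y
    obtain ⟨p, rfl⟩ := AdjoinRoot.mk_surjective y
    by_cases h1 : g = 1
    · refine ⟨0, ?_⟩
      rw [map_zero, eq_comm, AdjoinRoot.mk_eq_zero, h1]
      exact one_dvd p
    · have hdeg : (p %ₘ g).natDegree < n := (natDegree_modByMonic_lt p hg h1).trans_le hn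
      refine ⟨polyWord n (p %ₘ g), ?_⟩
      change AdjoinRoot.mk g (wordPoly n (polyWord n (p %ₘ g))) = _
      rw [wordPoly_polyWord hdeg, AdjoinRoot.mk_eq_mk, ← dvd_neg, neg_sub]
      exact ⟨p /ₘ g, sub_eq_of_eq_add' (modByMonic_add_div p g).symm⟩
  have := LinearMap.finrank_range_add_finrank_ker φ
  rw [LinearMap.range_eq_top.2 hsurj, finrank_top, hker, Module.finrank_fin_fun,
    (AdjoinRoot.powerBasis' hg).finrank, AdjoinRoot.powerBasis'_dim] at this
  omega

variable [NeZero n]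

/-- The word read cyclically from position `t` on. -/
def cyclicShift (t : ℕ) (u : Fin n → F) : Fin n → F := fun j => u (Fin.ofNat n (t + j))

lemma ofNat_add_val (t : ℕ) (j : Fin n) : Fin.ofNat n (t + j) = Fin.ofNat n t + j := by
  ext
  simp [Fin.val_add]

/-- Reading a word from position `t` on divides its polynomial by `x^t`, modulo `x^n - 1`. -/
lemma dvd_X_pow_mul_wordPoly_cyclicShift_sub (t : ℕ) (u : Fin n → F) :
    X ^ n - 1 ∣ X ^ t * wordPoly n (cyclicShift t u) - wordPoly n u := by
  have hu : wordPoly n u =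
      ∑ j : Fin n, C (u (Fin.ofNat n (t + j))) * X ^ ((t + j) % n) := by
    rw [wordPoly_apply, ← Equiv.sum_comp (Equiv.addLeft (Fin.ofNat n t))]
    refine Finset.sum_congr rfl fun j _ => ?_
    simp only [Equiv.coe_addLeft, ← ofNat_add_val]
    rfl
  rw [hu, wordPoly_apply, Finset.mul_sum, ← Finset.sum_sub_distrib]
  refine Finset.dvd_sum fun j _ => ?_
  have key : (X ^ n - 1 : F[X]) ∣ X ^ (t + (j : ℕ)) - X ^ ((t + j) % n) := by
    have h : (X : F[X]) ^ (t + (j : ℕ)) - X ^ ((t + j) % n) =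
        X ^ ((t + j) % n) * ((X ^ n) ^ ((t + (j : ℕ)) / n) - 1 ^ ((t + (j : ℕ)) / n)) := by
      conv_lhs => rw [← Nat.mod_add_div (t + (j : ℕ)) n, Nat.mod_add_div (t + (j : ℕ)) n]
      rw [one_pow, mul_sub, mul_one, ← pow_mul, ← pow_add, Nat.mod_add_div]
    rw [h]
    exact (sub_dvd_pow_sub_pow _ _ _).mul_left _
  have h2 : X ^ t * (C (cyclicShift t u j) * X ^ (j : ℕ)) -
      C (u (Fin.ofNat n (t + j))) * X ^ ((t + j) % n) =
      C (u (Fin.ofNat n (t + j))) * (X ^ (t + (j : ℕ)) - X ^ ((t + j) % n)) := by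
    rw [cyclicShift]
    ring
  rw [h2]
  exact key.mul_left _

lemma isCoprime_X_pow_of_dvd {g : F[X]} (hg : g ∣ X ^ n - 1) (t : ℕ) : IsCoprime g (X ^ t) := by
  refine IsCoprime.pow_right (IsCoprime.of_isCoprime_of_dvd_left ?_ hg)
  refine ⟨-1, X ^ (n - 1), ?_⟩
  rw [← pow_succ, Nat.sub_add_cancel (NeZero.one_le)]
  ring

lemma cyclicShift_mem_cyclicCode {g : F[X]} (hg : g ∣ X ^ n - 1) {c : Fin n → F}
    (hc : c ∈ cyclicCode n g) (t : ℕ) : cyclicShift t c ∈ cyclicCode n g := by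
  rw [mem_cyclicCode] at hc ⊢
  refine (isCoprime_X_pow_of_dvd hg t).dvd_of_dvd_mul_left ?_
  exact (dvd_sub_left hc).1 (hg.trans (dvd_X_pow_mul_wordPoly_cyclicShift_sub t c))

/-- If `g = f * h` divides `x^n - 1` and `f` does not divide `x^s - 1` for `0 < s < n`, then words
of the coset `h + ⟨g⟩` read from different positions are different. -/
lemma eq_of_cyclicShift_eq {f h : F[X]} (hdvd : f * h ∣ X ^ n - 1) (hdeg : h.natDegree < n)
    (hf : HasPolyOrder f n) {t t' : ℕ} (ht : t < n) (ht' : t' < n) {c c' : Fin n → F}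
    (hc : c ∈ cyclicCode n (f * h)) (hc' : c' ∈ cyclicCode n (f * h))
    (heq : cyclicShift t (polyWord n h + c) = cyclicShift t' (polyWord n h + c')) : t = t' := by
  wlog hle : t ≤ t' generalizing t t' c c'
  · exact (this ht' ht hc' hc heq.symm (le_of_not_ge hle)).symm
  by_contra hne
  have hh : h ≠ 0 := by
    rintro rfl
    rw [mul_zero, zero_dvd_iff] at hdvd
    exact (monic_X_pow_sub_C (1 : F) (NeZero.ne n)).ne_zero (by simpa using hdvd)
  have key : ∀ (s : ℕ) (b : Fin n → F), b ∈ cyclicCode n (f * h) →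
      f * h ∣ X ^ s * wordPoly n (cyclicShift s (polyWord n h + b)) - h := by
    intro s b hb
    have h1 := hdvd.trans (dvd_X_pow_mul_wordPoly_cyclicShift_sub s (polyWord n h + b))
    rw [map_add, wordPoly_polyWord hdeg] at h1
    have h2 := dvd_add h1 (mem_cyclicCode.1 hb)
    convert h2 using 1
    ring
  have h1 := (key t c hc).mul_left (X ^ (t' - t))
  have h2 := key t' c' hc'
  rw [← heq] at h2
  have h3 := dvd_sub h2 h1
  have h4 : X ^ t' * wordPoly n (cyclicShift t (polyWord n h + c)) - h -
      X ^ (t' - t) * (X ^ t * wordPoly n (cyclicShift t (polyWord n h + c)) - h) =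
      (X ^ (t' - t) - 1) * h := by
    conv_lhs => rw [← Nat.sub_add_cancel hle, pow_add, Nat.sub_add_cancel hle]
    ring
  rw [h4] at h3
  have h5 := hf.2 ⟨by omega, (mul_dvd_mul_iff_right hh).1 h3⟩
  omega

/-- If `x` is orthogonal to all shifts of `c` then `x(ζ⁻¹) c(ζ) = 0` for each `n`-th root of
unity `ζ`. -/
lemma aeval_inv_mul_aeval_eq_zero {K : Type*} [Field K] [Algebra F K] {x c : Fin n → F}
    (h : ∀ t, x ⬝ᵥ cyclicShift t c = 0) {ζ : K} (hζ : ζ ^ n = 1) :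
    aeval ζ⁻¹ (wordPoly n x) * aeval ζ (wordPoly n c) = 0 := by
  have hζ0 : ζ ≠ 0 := by
    rintro rfl
    rw [zero_pow (NeZero.ne n)] at hζ
    exact zero_ne_one hζ
  have hpow : ∀ t j : Fin n, ζ ^ ((t + j : Fin n) : ℕ) = ζ ^ (t : ℕ) * ζ ^ (j : ℕ) := by
    intro t j
    rw [Fin.val_add, ← pow_add]
    conv_rhs => rw [← Nat.mod_add_div ((t : ℕ) + j) n, pow_add, pow_mul, hζ, one_pow, mul_one]
  have hc : ∀ j : Fin n, aeval ζ (wordPoly n c) =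
      ζ ^ (j : ℕ) * ∑ t : Fin n, algebraMap F K (c (t + j)) * ζ ^ (t : ℕ) := by
    intro j
    rw [wordPoly_apply, map_sum, ← Equiv.sum_comp (Equiv.addRight j), Finset.mul_sum]
    refine Finset.sum_congr rfl fun t _ => ?_
    simp only [Equiv.coe_addRight, map_mul, aeval_C, map_pow, aeval_X, hpow]
    ring
  have hx : aeval ζ⁻¹ (wordPoly n x) =
      ∑ j : Fin n, algebraMap F K (x j) * (ζ ^ (j : ℕ))⁻¹ := by
    simp [wordPoly_apply, map_sum]
  rw [hx, Finset.sum_mul]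
  calc ∑ j : Fin n, algebraMap F K (x j) * (ζ ^ (j : ℕ))⁻¹ * aeval ζ (wordPoly n c)
      = ∑ j : Fin n, ∑ t : Fin n,
          ζ ^ (t : ℕ) * (algebraMap F K (x j) * algebraMap F K (c (t + j))) := by
        refine Finset.sum_congr rfl fun j _ => ?_
        rw [hc j, ← mul_assoc, mul_assoc (algebraMap F K (x j)),
          inv_mul_cancel₀ (pow_ne_zero _ hζ0), mul_one, Finset.mul_sum]
        exact Finset.sum_congr rfl fun t _ => by ring
    _ = ∑ t : Fin n, ζ ^ (t : ℕ) * algebraMap F K (x ⬝ᵥ cyclicShift t c) := by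
        rw [Finset.sum_comm]
        refine Finset.sum_congr rfl fun t _ => ?_
        rw [← Finset.mul_sum, dotProduct, map_sum]
        congr 1
        refine Finset.sum_congr rfl fun j _ => ?_
        rw [map_mul, cyclicShift, ofNat_add_val, Fin.ofNat_val_eq_self]
    _ = 0 := by simp [h]

end CyclicCodes

/-! ### Polynomials with prescribed roots of unity as zeros -/

section ClassPoly

variable {K : Type*} [Field K] {q : ℕ} {η : K}

lemma pow_val_natCast_mul (hη : IsPrimitiveRoot η (2 * q)) (r : ℕ) (j : ZMod (2 * q)) :
    η ^ ((r : ZMod (2 * q)) * j).val = (η ^ j.val) ^ r := by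
  rw [ZMod.val_mul, ZMod.val_natCast, Nat.mod_mul_mod, ← pow_mul, mul_comm j.val,
    ← pow_eq_pow_mod _ hη.pow_eq_one]

lemma monic_classPoly (η : K) (S : Finset (ZMod (2 * q))) : (classPoly η S).Monic :=
  monic_prod_of_monic _ _ fun _ _ => monic_X_sub_C _

lemma natDegree_classPoly (η : K) (S : Finset (ZMod (2 * q))) :
    (classPoly η S).natDegree = S.card := by
  rw [classPoly, natDegree_prod_of_monic _ _ fun _ _ => monic_X_sub_C _]
  simp only [natDegree_X_sub_C, Finset.sum_const, smul_eq_mul, mul_one]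

/-- An exponent set stable under multiplication by the characteristic `r` gives a polynomial which
is fixed by the Frobenius map, so that its coefficients lie in the prime field. -/
lemma exists_map_eq_classPoly {r : ℕ} [Fact r.Prime] [Algebra (ZMod r) K]
    (hη : IsPrimitiveRoot η (2 * q)) (hr : IsUnit (r : ZMod (2 * q))) {S : Finset (ZMod (2 * q))}
    (hS : ∀ j ∈ S, (r : ZMod (2 * q)) * j ∈ S) :
    ∃ p : (ZMod r)[X], p.map (algebraMap (ZMod r) K) = classPoly η S := by
  have : CharP K r := charP_of_injective_algebraMap (algebraMap (ZMod r) K).injective r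
  have hfrob : (classPoly η S).map (frobenius K r) = classPoly η S := by
    have hinj : Function.Injective fun j : ZMod (2 * q) => (r : ZMod (2 * q)) * j :=
      hr.mul_right_injective
    have himage : S.image (fun j => (r : ZMod (2 * q)) * j) = S := by
      refine Finset.eq_of_subset_of_card_le (Finset.image_subset_iff.2 hS) ?_
      rw [Finset.card_image_of_injective _ hinj]
    conv_rhs => rw [classPoly, ← himage, Finset.prod_image hinj.injOn]
    rw [classPoly, Polynomial.map_prod]
    refine Finset.prod_congr rfl fun j _ => ?_
    rw [Polynomial.map_sub, map_X, map_C, frobenius_def, pow_val_natCast_mul hη]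
  suffices classPoly η S ∈ lifts (algebraMap (ZMod r) K) from (mem_lifts _).1 this
  rw [lifts_iff_coeff_lifts]
  intro n
  have hn : (classPoly η S).coeff n ^ r = (classPoly η S).coeff n := by
    conv_rhs => rw [← hfrob, coeff_map, frobenius_def]
  rw [← Subfield.mem_bot_iff_pow_eq_self (F := K) (p := r),
    ← ZMod.fieldRange_castHom_eq_bot r] at hn
  obtain ⟨a, ha⟩ := hn
  exact ⟨a, by rw [← ha]; exact congrArg (fun φ : ZMod r →+* K => φ a) (Subsingleton.elim _ _)⟩

variable [NeZero (2 * q)]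

lemma pow_val_add (hη : IsPrimitiveRoot η (2 * q)) (j k : ZMod (2 * q)) :
    η ^ (j + k).val = η ^ j.val * η ^ k.val := by
  rw [ZMod.val_add, ← pow_add, ← pow_eq_pow_mod _ hη.pow_eq_one]

lemma inv_pow_val_neg (hη : IsPrimitiveRoot η (2 * q)) (j : ZMod (2 * q)) :
    (η ^ (-j).val)⁻¹ = η ^ j.val := by
  refine inv_eq_of_mul_eq_one_right ?_
  rw [← pow_val_add hη, neg_add_cancel, ZMod.val_zero, pow_zero]

lemma pow_val_injective (hη : IsPrimitiveRoot η (2 * q)) :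
    Function.Injective fun j : ZMod (2 * q) => η ^ j.val :=
  fun _ _ h => ZMod.val_injective _ (hη.pow_inj (ZMod.val_lt _) (ZMod.val_lt _) h)

lemma eval_classPoly_eq_zero_iff (hη : IsPrimitiveRoot η (2 * q)) (S : Finset (ZMod (2 * q)))
    (j : ZMod (2 * q)) : (classPoly η S).eval (η ^ j.val) = 0 ↔ j ∈ S := by
  rw [classPoly, eval_prod, Finset.prod_eq_zero_iff]
  constructor
  · rintro ⟨k, hk, h⟩
    rw [eval_sub, eval_X, eval_C, sub_eq_zero] at h
    rwa [pow_val_injective hη h]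
  · intro h
    exact ⟨j, h, by simp⟩

lemma classPoly_dvd_iff (hη : IsPrimitiveRoot η (2 * q)) (S : Finset (ZMod (2 * q))) (p : K[X]) :
    classPoly η S ∣ p ↔ ∀ j ∈ S, p.eval (η ^ j.val) = 0 := by
  constructor
  · intro h j hj
    exact eval_eq_zero_of_dvd_of_eval_eq_zero h ((eval_classPoly_eq_zero_iff hη S j).2 hj)
  · intro h
    refine Finset.prod_dvd_of_coprime ?_ fun j hj => dvd_iff_isRoot.2 (h j hj)
    exact (pairwise_coprime_X_sub_C (pow_val_injective hη)).set_pairwise _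

lemma classPoly_dvd_X_pow_sub_one (hη : IsPrimitiveRoot η (2 * q)) (S : Finset (ZMod (2 * q))) :
    classPoly η S ∣ X ^ (2 * q) - 1 := by
  refine (classPoly_dvd_iff hη S _).2 fun j _ => ?_
  rw [eval_sub, eval_pow, eval_X, eval_one, ← pow_mul, mul_comm, pow_mul, hη.pow_eq_one, one_pow,
    sub_self]

/-- If no zero `η ^ j` of the generator has its inverse among the zeros, then the cyclic code
contains its dual. -/
lemma dualCode_le_cyclicCode {F : Type*} [Field F] [Algebra F K]
    (hη : IsPrimitiveRoot η (2 * q)) {S : Finset (ZMod (2 * q))} {p : F[X]}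
    (hp : p.map (algebraMap F K) = classPoly η S) (hcard : S.card < 2 * q)
    (hneg : ∀ j ∈ S, -j ∉ S) :
    dualCode (cyclicCode (2 * q) p) ≤ cyclicCode (2 * q) p := by
  intro x hx
  have hdeg : p.natDegree < 2 * q := by
    rwa [← natDegree_map (algebraMap F K), hp, natDegree_classPoly]
  have hdvd : p ∣ X ^ (2 * q) - 1 := by
    rw [← map_dvd_map' (algebraMap F K), hp]
    simpa using classPoly_dvd_X_pow_sub_one hη S
  have hc : polyWord (2 * q) p ∈ cyclicCode (2 * q) p := by
    rw [mem_cyclicCode, wordPoly_polyWord hdeg]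
  rw [mem_cyclicCode, ← map_dvd_map' (algebraMap F K), hp, classPoly_dvd_iff hη]
  intro j hj
  have hζ : (η ^ (-j).val) ^ (2 * q) = 1 := by
    rw [← pow_mul, mul_comm, pow_mul, hη.pow_eq_one, one_pow]
  have key := aeval_inv_mul_aeval_eq_zero
    (fun t => hx _ (cyclicShift_mem_cyclicCode hdvd hc t)) hζ
  rw [inv_pow_val_neg hη, wordPoly_polyWord hdeg, mul_eq_zero] at key
  rw [eval_map_algebraMap]
  refine key.resolve_right ?_
  rw [← eval_map_algebraMap, hp, eval_classPoly_eq_zero_iff hη]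
  exact hneg j hj

/-- A divisor of `x^(2q) - 1` with a primitive `2q`-th root of unity among its zeros has the
largest possible order. -/
lemma hasPolyOrder_of_isUnit_mem {F : Type*} [Field F] [Algebra F K]
    (hη : IsPrimitiveRoot η (2 * q)) {S : Finset (ZMod (2 * q))} {p : F[X]}
    (hp : p.map (algebraMap F K) = classPoly η S) {j : ZMod (2 * q)} (hj : j ∈ S)
    (hunit : IsUnit j) : HasPolyOrder p (2 * q) := by
  constructor
  · refine ⟨Nat.pos_of_ne_zero (NeZero.ne _), ?_⟩
    rw [← map_dvd_map' (algebraMap F K), hp]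
    simpa using classPoly_dvd_X_pow_sub_one hη S
  · rintro k ⟨hk, hdvd⟩
    rw [← map_dvd_map' (algebraMap F K), hp, classPoly_dvd_iff hη] at hdvd
    have h := hdvd j hj
    obtain ⟨u, rfl⟩ := hunit
    have hprim := hη.pow_of_coprime _ (ZMod.val_coe_unit_coprime u)
    refine Nat.le_of_dvd hk (hprim.dvd_of_pow_eq_one _ ?_)
    simpa [sub_eq_zero] using h

end ClassPoly

/-! ### Orbits of a subgroup in a cyclotomic class -/

section Cosets

/-- The coset of the powers of `ρ` that contains `γ^(2t+i)`, where `ρ^l = 1`. -/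
def powCoset {M : Type*} [CommMonoid M] [DecidableEq M] (ρ γ : M) (l i t : ℕ) : Finset M :=
  (Finset.range l).image fun s => ρ ^ s * γ ^ (2 * t + i)

/-- The union of the cosets of the powers of `ρ` that contain `γ^(2t+i)` for `t < T`. -/
def powCosets {M : Type*} [CommMonoid M] [DecidableEq M] (ρ γ : M) (l i T : ℕ) : Finset M :=
  (Finset.range T).biUnion (powCoset ρ γ l i)

variable {M : Type*} [CommMonoid M] [DecidableEq M] {ρ γ : M} {l i T t : ℕ}

lemma powCosets_succ :
    powCosets ρ γ l i (T + 1) = powCoset ρ γ l i T ∪ powCosets ρ γ l i T := by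
  rw [powCosets, Finset.range_add_one, Finset.biUnion_insert, powCosets]

lemma mul_mem_powCoset (hρ : ρ ^ l = 1) (hl : 0 < l) {j : M} (hj : j ∈ powCoset ρ γ l i t) :
    ρ * j ∈ powCoset ρ γ l i t := by
  obtain ⟨s, -, rfl⟩ := Finset.mem_image.1 hj
  refine Finset.mem_image.2 ⟨(s + 1) % l, Finset.mem_range.2 (Nat.mod_lt _ hl), ?_⟩
  rw [← mul_assoc, ← pow_succ', ← pow_eq_pow_mod _ hρ]

lemma mul_mem_powCosets (hρ : ρ ^ l = 1) (hl : 0 < l) {j : M} (hj : j ∈ powCosets ρ γ l i T) :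
    ρ * j ∈ powCosets ρ γ l i T := by
  obtain ⟨t, ht, h⟩ := Finset.mem_biUnion.1 hj
  exact Finset.mem_biUnion.2 ⟨t, ht, mul_mem_powCoset hρ hl h⟩

/-- The `l`-th power of an element of a coset determines the coset. -/
lemma disjoint_powCoset {θ : ℕ} (hρ : ρ ^ l = 1) (hγ : IsUnit γ) (hord : orderOf γ = 2 * θ * l)
    (hl : 0 < l) {t' : ℕ} (ht : t < θ) (ht' : t' < θ) (hne : t ≠ t') :
    Disjoint (powCoset ρ γ l i t) (powCoset ρ γ l i t') := by
  rw [Finset.disjoint_left]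
  intro x hx hx'
  obtain ⟨s, -, rfl⟩ := Finset.mem_image.1 hx
  obtain ⟨s', -, h⟩ := Finset.mem_image.1 hx'
  have h1 := congrArg (· ^ l) h
  simp only [mul_pow, ← pow_mul, mul_comm _ l] at h1
  simp only [pow_mul ρ l, hρ, one_pow, one_mul] at h1
  obtain ⟨u, rfl⟩ := hγ
  rw [orderOf_units] at hord
  have h2 : u ^ (2 * t' * l) = u ^ (2 * t * l) := by
    have h3 : u ^ (l * (2 * t' + i)) = u ^ (l * (2 * t + i)) := Units.ext (by simpa using h1)
    rw [mul_add, mul_add, pow_add, pow_add] at h3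
    rw [mul_comm _ l, mul_comm _ l]
    exact mul_right_cancel h3
  have hlt : ∀ {k : ℕ}, k < θ → 2 * k * l < orderOf u := by
    intro k hk
    rw [hord]
    exact Nat.mul_lt_mul_of_pos_right (by omega) hl
  have h4 := pow_injOn_Iio_orderOf (hlt ht') (hlt ht) h2
  have h5 := Nat.eq_of_mul_eq_mul_right hl h4
  omega

lemma card_powCoset (hγ : IsUnit γ) (hρ : IsUnit ρ) (hord : orderOf ρ = l) :
    (powCoset ρ γ l i t).card = l := by
  rw [powCoset, Finset.card_image_of_injOn, Finset.card_range]
  intro s hs s' hs' h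
  have h1 := (hγ.pow (2 * t + i)).mul_left_injective h
  obtain ⟨u, rfl⟩ := hρ
  rw [orderOf_units] at hord
  rw [Finset.coe_range, ← hord] at hs hs'
  exact pow_injOn_Iio_orderOf hs hs' (Units.ext (by simpa using h1))

lemma card_powCosets {θ : ℕ} (hγ : IsUnit γ) (hρ : IsUnit ρ) (hρl : orderOf ρ = l)
    (hord : orderOf γ = 2 * θ * l) (hl : 0 < l) (hT : T ≤ θ) :
    (powCosets ρ γ l i T).card = T * l := by
  rw [powCosets, Finset.card_biUnion]
  · simp [card_powCoset hγ hρ hρl]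
  · intro t ht t' ht' hne
    exact disjoint_powCoset (hρl ▸ pow_orderOf_eq_one ρ) hγ hord hl
      ((Finset.mem_range.1 ht).trans_le hT) ((Finset.mem_range.1 ht').trans_le hT) hne

end Cosets

section CyclotomicClass

variable {q g i : ℕ}

lemma powCosets_subset_cyclotomicClassD {a : ℕ} (l T : ℕ)
    (hg : (g : ZMod (2 * q)) ^ (q - 1) = 1) (hq : Odd q) (hq1 : 1 < q) :
    powCosets ((g : ZMod (2 * q)) ^ (2 * a)) (g : ZMod (2 * q)) l i T ⊆
      cyclotomicClassD q g i := by
  intro x hx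
  obtain ⟨t, -, hx⟩ := Finset.mem_biUnion.1 hx
  obtain ⟨s, -, rfl⟩ := Finset.mem_image.1 hx
  obtain ⟨k, rfl⟩ := hq
  have hk : (2 * k + 1 - 1) / 2 = k := by omega
  refine Finset.mem_image.2 ⟨(a * s + t) % k, ?_, ?_⟩
  · rw [hk]
    exact Finset.mem_range.2 (Nat.mod_lt _ (by omega))
  · rw [Nat.add_sub_cancel] at hg
    have h : ((g : ZMod (2 * (2 * k + 1))) ^ 2) ^ k = 1 := by rw [← pow_mul, hg]
    rw [pow_add, pow_mul _ 2 (_ % k), ← pow_eq_pow_mod _ h]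
    ring

lemma mul_mem_cyclotomicClassD {a : ℕ} (hg : (g : ZMod (2 * q)) ^ (q - 1) = 1) (hq : Odd q)
    (hq1 : 1 < q) {j : ZMod (2 * q)} (hj : j ∈ cyclotomicClassD q g i) :
    (g : ZMod (2 * q)) ^ (2 * a) * j ∈ cyclotomicClassD q g i := by
  obtain ⟨t, -, rfl⟩ := Finset.mem_image.1 hj
  refine powCosets_subset_cyclotomicClassD 2 (t + 1) hg hq hq1 (a := a) ?_
  refine Finset.mem_biUnion.2 ⟨t, by simp, Finset.mem_image.2 ⟨1, by simp, by rw [pow_one]⟩⟩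

/-- As `(q - 1) / 2` is odd, `-1` is not a square modulo `2q`: its `(q - 1) / 2`-th power is `-1`,
while that of a quotient of two elements of a cyclotomic class is `1`. -/
lemma neg_notMem_cyclotomicClassD {m : ℕ} (hqm : q = 4 * m + 3) (hunit : IsUnit (g : ZMod (2 * q)))
    (hg : (g : ZMod (2 * q)) ^ (q - 1) = 1) {j : ZMod (2 * q)}
    (hj : j ∈ cyclotomicClassD q g i) : -j ∉ cyclotomicClassD q g i := by
  have hpow : ∀ k ∈ cyclotomicClassD q g i,
      k ^ (2 * m + 1) = (g : ZMod (2 * q)) ^ (i * (2 * m + 1)) := by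
    intro k hk
    obtain ⟨s, -, rfl⟩ := Finset.mem_image.1 hk
    have h : (2 * s + i) * (2 * m + 1) = (q - 1) * s + i * (2 * m + 1) := by
      rw [hqm, show 4 * m + 3 - 1 = 2 * (2 * m + 1) by omega]
      ring
    rw [← pow_mul, h, pow_add, pow_mul, hg, one_pow, one_mul]
  intro hneg
  have h1 := hpow _ hneg
  rw [Odd.neg_pow ⟨m, rfl⟩, hpow j hj, neg_eq_iff_add_eq_zero, ← two_mul,
    (hunit.pow _).mul_left_eq_zero] at h1
  have h2 : ((2 : ℕ) : ZMod (2 * q)) = 0 := by exact_mod_cast h1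
  rw [ZMod.natCast_eq_zero_iff] at h2
  have := Nat.le_of_dvd two_pos h2
  omega

end CyclotomicClass

/-! ### Recovery from errors with mutually orthogonal images -/

section Recovery

variable {ι : Type*} [Fintype ι] [DecidableEq ι]

/-- The matrix of the orthogonal projection onto a subspace. -/
lemma exists_projection_matrix (Q : Submodule ℂ (ι → ℂ)) :
    ∃ P : Matrix ι ι ℂ, IsStarProjection P ∧ (∀ ψ ∈ Q, P.mulVec ψ = ψ) ∧
      ∀ ψ, P.mulVec ψ ∈ Q := by
  let U : Submodule ℂ (EuclideanSpace ℂ ι) := Q.comap (WithLp.linearEquiv 2 ℂ (ι → ℂ)).toLinearMap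
  let P : Matrix ι ι ℂ := (Matrix.toEuclideanCLM (n := ι) (𝕜 := ℂ)).symm U.starProjection
  have hP : Matrix.toEuclideanCLM (n := ι) (𝕜 := ℂ) P = U.starProjection :=
    StarAlgEquiv.apply_symm_apply _ _
  have hmul : ∀ ψ : ι → ℂ, P.mulVec ψ = WithLp.ofLp (U.starProjection (WithLp.toLp 2 ψ)) := by
    intro ψ
    rw [← hP, Matrix.ofLp_toEuclideanCLM]
  refine ⟨P, ?_, fun ψ hψ => ?_, fun ψ => ?_⟩
  · have hU := isStarProjection_starProjection (U := U)
    constructor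
    · refine EquivLike.injective (Matrix.toEuclideanCLM (n := ι) (𝕜 := ℂ)) ?_
      rw [map_mul, hP, hU.isIdempotentElem.eq]
    · refine EquivLike.injective (Matrix.toEuclideanCLM (n := ι) (𝕜 := ℂ)) ?_
      rw [map_star, hP, hU.isSelfAdjoint.star_eq]
  · have hU : WithLp.toLp 2 ψ ∈ U := hψ
    rw [hmul, Submodule.starProjection_eq_self_iff.2 hU]
  · rw [hmul]
    exact U.starProjection_apply_mem (WithLp.toLp 2 ψ)

lemma matrix_eq_zero_of_dotProduct {B : Matrix ι ι ℂ}
    (h : ∀ x y : ι → ℂ, star x ⬝ᵥ B.mulVec y = 0) : B = 0 := by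
  ext i j
  have := h (Pi.single i 1) (Pi.single j 1)
  simpa [Pi.star_def, Pi.single_apply, dotProduct, Matrix.mulVec, apply_ite] using this

/-- Unitary errors that carry a code `Q` onto mutually orthogonal subspaces are corrected by the
channel which measures in which of these subspaces the state is, and then inverts the error. -/
lemma exists_recovery {κ : Type*} [Fintype κ] (Q : Submodule ℂ (ι → ℂ))
    (A : κ → Matrix ι ι ℂ) (hA : ∀ k, (A k).conjTranspose * A k = 1)
    (horth : ∀ k k', k ≠ k' → ∀ ψ ∈ Q, ∀ φ ∈ Q,
      star ((A k).mulVec ψ) ⬝ᵥ (A k').mulVec φ = 0) :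
    ∃ (M : ℕ) (R : Fin M → Matrix ι ι ℂ), ∑ k, (R k).conjTranspose * R k = 1 ∧
      ∀ j k, ∃ c : ℂ, ∀ ψ ∈ Q, (R j).mulVec ((A k).mulVec ψ) = c • ψ := by
  classical
  obtain ⟨P, hP, hfix, hmem⟩ := exists_projection_matrix Q
  have hPP : P * P = P := hP.isIdempotentElem
  have hPs : P.conjTranspose = P := hP.isSelfAdjoint
  have hcross : ∀ k k', k ≠ k' → P * (A k).conjTranspose * (A k' * P) = 0 := by
    intro k k' hne
    refine matrix_eq_zero_of_dotProduct fun x y => ?_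
    have := horth k k' hne _ (hmem x) _ (hmem y)
    simpa only [Matrix.star_mulVec, Matrix.mulVec_mulVec, Matrix.dotProduct_mulVec,
      Matrix.vecMul_vecMul, Matrix.conjTranspose_mul, hPs, Matrix.mul_assoc] using this
  have hsame : ∀ k, P * (A k).conjTranspose * (A k * P) = P := by
    intro k
    rw [Matrix.mul_assoc, ← Matrix.mul_assoc _ (A k), hA, Matrix.one_mul, hPP]
  -- the projection onto the image of `Q` under the error `A k`
  let E : κ → Matrix ι ι ℂ := fun k => A k * P * (A k).conjTranspose
  have hE : ∀ k k', E k * E k' = if k = k' then E k else 0 := by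
    intro k k'
    have h : E k * E k' =
        A k * (P * (A k).conjTranspose * (A k' * P)) * (A k').conjTranspose := by
      simp only [E, Matrix.mul_assoc]
    split_ifs with hk
    · subst hk
      rw [h, hsame]
    · rw [h, hcross k k' hk, Matrix.mul_zero, Matrix.zero_mul]
  have hEs : ∀ k, (E k).conjTranspose = E k := by
    intro k
    simp only [E, Matrix.conjTranspose_mul, Matrix.conjTranspose_conjTranspose, hPs,
      Matrix.mul_assoc]
  have hEA : ∀ k k', E k * (A k' * P) = if k = k' then A k' * P else 0 := by
    intro k k'
    have h : E k * (A k' * P) = A k * (P * (A k).conjTranspose * (A k' * P)) := by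
      simp only [E, Matrix.mul_assoc]
    split_ifs with hk
    · subst hk
      rw [h, hsame]
    · rw [h, hcross k k' hk, Matrix.mul_zero]
  let R : Option κ → Matrix ι ι ℂ := fun o => o.elim (1 - ∑ k, E k) fun k => P * (A k).conjTranspose
  have hR : ∑ o, (R o).conjTranspose * R o = 1 := by
    rw [Fintype.sum_option]
    have h1 : (R none).conjTranspose * R none = 1 - ∑ k, E k := by
      simp only [R, Option.elim, Matrix.conjTranspose_sub, Matrix.conjTranspose_one,
        Matrix.conjTranspose_sum, hEs, Matrix.sub_mul, Matrix.one_mul, Matrix.mul_sub,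
        Matrix.mul_one, Finset.sum_mul, Finset.mul_sum, hE]
      simp
    have h2 : ∀ k, (R (some k)).conjTranspose * R (some k) = E k := by
      intro k
      simp only [R, E, Option.elim, Matrix.conjTranspose_mul, Matrix.conjTranspose_conjTranspose,
        hPs, Matrix.mul_assoc]
      rw [← Matrix.mul_assoc P P, hPP]
    rw [h1, Finset.sum_congr rfl fun k _ => h2 k, sub_add_cancel]
  have hRA : ∀ o k, ∃ c : ℂ, R o * (A k * P) = c • P := by
    intro o k
    cases o with
    | none =>
      refine ⟨0, ?_⟩
      simp only [R, Option.elim, Matrix.sub_mul, Matrix.one_mul, Finset.sum_mul, hEA]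
      simp
    | some k' =>
      by_cases hk : k' = k
      · subst hk
        exact ⟨1, by rw [one_smul]; exact hsame k'⟩
      · exact ⟨0, by rw [zero_smul]; exact hcross k' k hk⟩
  let e := Fintype.equivFin (Option κ)
  refine ⟨Fintype.card (Option κ), R ∘ e.symm, ?_, fun j k => ?_⟩
  · rw [← hR, ← Equiv.sum_comp e.symm]
    rfl
  · obtain ⟨c, hc⟩ := hRA (e.symm j) k
    refine ⟨c, fun ψ hψ => ?_⟩
    conv_lhs => rw [← hfix ψ hψ]
    rw [Matrix.mulVec_mulVec, Matrix.mulVec_mulVec, Function.comp_apply, Matrix.mul_assoc, hc,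
      Matrix.smul_mulVec, hfix ψ hψ]

end Recovery

/-! ### Generalized Pauli errors -/

section Pauli

variable {r : ℕ} [NeZero r] {κ : Type} [Fintype κ]

/-- The generalized Pauli error as a matrix. -/
noncomputable def pauliMatrix [DecidableEq κ] (e p : κ → ZMod r) : QOp r κ :=
  Matrix.of fun w u => if u = w - e then ZMod.stdAddChar (p ⬝ᵥ (w - e)) else 0

lemma pauliMatrix_mulVec [DecidableEq κ] (e p : κ → ZMod r) (ψ : QState r κ) :
    (pauliMatrix e p).mulVec ψ = pauli e p ψ := by
  funext w
  simp [pauliMatrix, Matrix.mulVec, dotProduct, pauli]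

lemma star_stdAddChar_mul (a b : ZMod r) :
    star (ZMod.stdAddChar a : ℂ) * ZMod.stdAddChar b = ZMod.stdAddChar (b - a) := by
  rw [AddChar.map_sub_eq_div, div_eq_mul_inv, mul_comm, ← AddChar.map_neg_eq_inv,
    AddChar.map_neg_eq_conj]
  rfl

lemma star_pauli_dotProduct_pauli [DecidableEq κ] (e p p' : κ → ZMod r) (ψ φ : QState r κ) :
    star (pauli e p ψ) ⬝ᵥ pauli e p' φ =
      ∑ w, ZMod.stdAddChar ((p' - p) ⬝ᵥ w) * (star (ψ w) * φ w) := by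
  rw [dotProduct, ← Equiv.sum_comp (Equiv.addRight e)]
  refine Finset.sum_congr rfl fun w _ => ?_
  simp only [Equiv.coe_addRight, Pi.star_apply, pauli, add_sub_cancel_right, star_mul,
    sub_dotProduct]
  rw [← star_stdAddChar_mul]
  ring

lemma pauliMatrix_conjTranspose_mul_self [DecidableEq κ] (e p : κ → ZMod r) :
    (pauliMatrix e p).conjTranspose * pauliMatrix e p = 1 := by
  rw [← sub_eq_zero]
  refine matrix_eq_zero_of_dotProduct fun x y => ?_
  rw [Matrix.sub_mulVec, ← Matrix.mulVec_mulVec, dotProduct_sub, Matrix.one_mulVec,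
    Matrix.dotProduct_mulVec, ← Matrix.star_mulVec, pauliMatrix_mulVec, pauliMatrix_mulVec,
    star_pauli_dotProduct_pauli]
  simp [dotProduct]

end Pauli

/-! ### Codes of coset states on a repeated register -/

section CosetCode

variable {r n : ℕ} [Fact r.Prime] {κ : Type}

lemma add_comp_injective {v : Fin n → ZMod r} {π : κ → Fin n} (hπ : Function.Surjective π) :
    Function.Injective fun c : Fin n → ZMod r => (v + c) ∘ π := fun _ _ h =>
  add_left_cancel (hπ.injective_comp_right h)

variable [Fintype κ]

/-- The space spanned by the coset states `∑_{x ∈ D^⊥} |v + c + x⟩`, `c ∈ D`, of a code `D` that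
contains its dual, shifted by a fixed word `v`, where the qudit at position `i` of the register
holds a copy of the letter number `π i`. It is described as the space of the states supported on
the copies of the words in `v + D` and invariant under translation by the copies of words in the
dual code. -/
noncomputable def cosetCodeSpace (D : Submodule (ZMod r) (Fin n → ZMod r)) (v : Fin n → ZMod r)
    (π : κ → Fin n) : Submodule ℂ (QState r κ) where
  carrier := {ψ | (∀ w, ψ w ≠ 0 → ∃ c ∈ D, w = (v + c) ∘ π) ∧
    ∀ x ∈ dualCode D, ∀ w, ψ (w + x ∘ π) = ψ w}
  zero_mem' := by simp
  add_mem' := by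
    rintro ψ φ ⟨h1, h2⟩ ⟨h3, h4⟩
    refine ⟨fun w hw => ?_, fun x hx w => by simp [h2 x hx, h4 x hx]⟩
    by_cases hψ : ψ w = 0
    · refine h3 w fun hφ => hw ?_
      simp [hψ, hφ]
    · exact h1 w hψ
  smul_mem' := by
    rintro a ψ ⟨h1, h2⟩
    refine ⟨fun w hw => h1 w fun h => hw (by simp [h]), fun x hx w => by simp [h2 x hx]⟩

variable {D : Submodule (ZMod r) (Fin n → ZMod r)} {v : Fin n → ZMod r} {π : κ → Fin n}

/-- A state of the code is a function on the quotient of `D` by its dual. -/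
lemma finrank_cosetCodeSpace (hπ : Function.Surjective π) (hD : dualCode D ≤ D) {k : ℕ}
    (hk : 2 * Module.finrank (ZMod r) D = n + k) :
    Module.finrank ℂ (cosetCodeSpace D v π) = r ^ k := by
  classical
  let S : Submodule (ZMod r) D := (dualCode D).submoduleOf D
  let L : cosetCodeSpace D v π →ₗ[ℂ] ((D ⧸ S) → ℂ) :=
    { toFun := fun ψ a => ψ.1 ((v + (Quotient.out a : D).1) ∘ π)
      map_add' := fun _ _ => rfl
      map_smul' := fun _ _ => rfl }
  have hL : ∀ (ψ : cosetCodeSpace D v π) (c : D),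
      L ψ (Submodule.Quotient.mk c) = ψ.1 ((v + c.1) ∘ π) := by
    intro ψ c
    have h : (Submodule.Quotient.mk (Quotient.out (Submodule.Quotient.mk c : D ⧸ S)) : D ⧸ S) =
        Submodule.Quotient.mk c := Quotient.out_eq _
    rw [Submodule.Quotient.eq] at h
    have h' : ((Quotient.out (Submodule.Quotient.mk c : D ⧸ S)) - c : D).1 ∈ dualCode D := h
    rw [← ψ.2.2 _ h' ((v + c.1) ∘ π)]
    exact congrArg ψ.1 (funext fun i => by simp)
  have hinj : Function.Injective L := by
    intro ψ φ h
    ext w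
    have key : ∀ c ∈ D, ψ.1 ((v + c) ∘ π) = φ.1 ((v + c) ∘ π) := by
      intro c hc
      rw [← hL ψ ⟨c, hc⟩, ← hL φ ⟨c, hc⟩, h]
    by_cases hψ : ψ.1 w = 0
    · by_cases hφ : φ.1 w = 0
      · rw [hψ, hφ]
      · obtain ⟨c, hc, rfl⟩ := φ.2.1 w hφ
        exact key c hc
    · obtain ⟨c, hc, rfl⟩ := ψ.2.1 w hψ
      exact key c hc
  have hsurj : Function.Surjective L := by
    intro a
    let ψ : QState r κ := fun w =>
      if h : ∃ c : D, w = (v + c.1) ∘ π then a (Submodule.Quotient.mk h.choose) else 0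
    have hψ : ∀ c : D, ψ ((v + c.1) ∘ π) = a (Submodule.Quotient.mk c) := by
      intro c
      have h : ∃ c' : D, (v + c.1) ∘ π = (v + c'.1) ∘ π := ⟨c, rfl⟩
      simp only [ψ, dif_pos h]
      congr 2
      exact Subtype.ext (add_comp_injective hπ h.choose_spec.symm)
    have hmem : ψ ∈ cosetCodeSpace D v π := by
      constructor
      · intro w hw
        by_contra hne
        refine hw (dif_neg ?_)
        rintro ⟨c, hc⟩
        exact hne ⟨c.1, c.2, hc⟩
      · intro x hx w
        have hadd : ∀ c : D, (v + c.1) ∘ π + x ∘ π = (v + (c + ⟨x, hD hx⟩ : D).1) ∘ π := by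
          intro c
          funext i
          simp [add_assoc]
        by_cases hw : ∃ c : D, w = (v + c.1) ∘ π
        · obtain ⟨c, rfl⟩ := hw
          rw [hadd, hψ, hψ]
          congr 1
          rw [Submodule.Quotient.eq, add_sub_cancel_left]
          exact hx
        · have hw' : ¬ ∃ c : D, w + x ∘ π = (v + c.1) ∘ π := by
            rintro ⟨c, hc⟩
            refine hw ⟨c - ⟨x, hD hx⟩, ?_⟩
            have h2 := hadd (c - ⟨x, hD hx⟩)
            rw [sub_add_cancel, ← hc] at h2
            exact (add_right_cancel h2).symm
          simp only [ψ, dif_neg hw, dif_neg hw']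
    refine ⟨⟨ψ, hmem⟩, funext fun b => ?_⟩
    obtain ⟨c, rfl⟩ := Submodule.Quotient.mk_surjective S b
    rw [hL]
    exact hψ c
  have hS : Module.finrank (ZMod r) S = n - Module.finrank (ZMod r) D := by
    rw [(Submodule.submoduleOfEquivOfLe hD).finrank_eq, finrank_dualCode]
  have hle : Module.finrank (ZMod r) D ≤ n := by
    simpa using Submodule.finrank_le D
  have hquot := Submodule.finrank_quotient_add_finrank S
  have hfin : Module.finrank (ZMod r) (D ⧸ S) = k := by omega
  have : Fintype (D ⧸ S) := Fintype.ofFinite _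
  rw [(LinearEquiv.ofBijective L ⟨hinj, hsurj⟩).finrank_eq, Module.finrank_fintype_fun_eq_card,
    Module.card_eq_pow_finrank (K := ZMod r), ZMod.card, hfin]

/-! ### Correction of bit and phase errors -/

/-- The letterwise sums of a vector over the copies of each letter. This is the transpose of
`u ↦ u ∘ π`. -/
def fiberSum [DecidableEq κ] (π : κ → Fin n) (p : κ → ZMod r) : Fin n → ZMod r :=
  fun j => ∑ i with π i = j, p i

lemma dotProduct_comp [DecidableEq κ] (p : κ → ZMod r) (u : Fin n → ZMod r) :
    p ⬝ᵥ (u ∘ π) = fiberSum π p ⬝ᵥ u := by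
  simp only [dotProduct, fiberSum, Finset.sum_mul]
  rw [← Finset.sum_fiberwise Finset.univ π]
  refine Finset.sum_congr rfl fun j _ => Finset.sum_congr rfl fun i hi => ?_
  rw [Function.comp_apply, (Finset.mem_filter.1 hi).2]

lemma hammingNorm_fiberSum_le [DecidableEq κ] (p : κ → ZMod r) :
    hammingNorm (fiberSum π p) ≤ hammingNorm p := by
  refine le_trans (Finset.card_le_card ?_) (Finset.card_image_le (f := π))
  intro j hj
  obtain ⟨i, hi, hne⟩ := Finset.exists_ne_zero_of_sum_ne_zero (Finset.mem_filter.1 hj).2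
  exact Finset.mem_image.2
    ⟨i, Finset.mem_filter.2 ⟨Finset.mem_univ _, hne⟩, (Finset.mem_filter.1 hi).2⟩

lemma hammingNorm_comp_le {σ : Fin n → κ} (hσ : Function.Injective σ) (e : κ → ZMod r) :
    hammingNorm (e ∘ σ) ≤ hammingNorm e := by
  refine Finset.card_le_card_of_injOn σ (fun j hj => ?_) hσ.injOn
  simpa [hammingNorm] using hj

/-- On coset states a phase error acts through its letterwise sums only. -/
lemma pauli_eq_of_fiberSum_eq [DecidableEq κ] {e p p' : κ → ZMod r}
    (h : fiberSum π p = fiberSum π p') {ψ : QState r κ} (hψ : ψ ∈ cosetCodeSpace D v π) :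
    pauli e p ψ = pauli e p' ψ := by
  funext w
  by_cases h0 : ψ (w - e) = 0
  · simp [pauli, h0]
  · obtain ⟨c, -, hc⟩ := hψ.1 _ h0
    simp only [pauli]
    rw [hc, dotProduct_comp, dotProduct_comp, h]

/-- Different phase errors lead to orthogonal states unless their letterwise sums differ by a word
of the code: a translation by a dual word multiplies the inner product by a nontrivial phase. -/
lemma star_pauli_dotProduct_pauli_eq_zero [DecidableEq κ] {e p p' : κ → ZMod r}
    (h : fiberSum π p' - fiberSum π p ∉ D) {ψ φ : QState r κ}
    (hψ : ψ ∈ cosetCodeSpace D v π) (hφ : φ ∈ cosetCodeSpace D v π) :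
    star (pauli e p ψ) ⬝ᵥ pauli e p' φ = 0 := by
  rw [← dualCode_dualCode D] at h
  obtain ⟨x, hx, hne⟩ : ∃ x ∈ dualCode D, (fiberSum π p' - fiberSum π p) ⬝ᵥ x ≠ 0 := by
    by_contra hcon
    push Not at hcon
    exact h hcon
  rw [star_pauli_dotProduct_pauli]
  set s := ∑ w, (ZMod.stdAddChar ((p' - p) ⬝ᵥ w) : ℂ) * (star (ψ w) * φ w) with hs
  have hshift : s = ZMod.stdAddChar ((p' - p) ⬝ᵥ (x ∘ π)) * s := by
    conv_lhs => rw [hs, ← Equiv.sum_comp (Equiv.addRight (x ∘ π))]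
    rw [hs, Finset.mul_sum]
    refine Finset.sum_congr rfl fun w _ => ?_
    rw [Equiv.coe_addRight, hψ.2 x hx, hφ.2 x hx, dotProduct_add, AddChar.map_add_eq_mul]
    ring
  by_contra hs0
  have h1 : (ZMod.stdAddChar ((p' - p) ⬝ᵥ (x ∘ π)) : ℂ) = 1 :=
    mul_right_cancel₀ hs0 (by rw [one_mul]; exact hshift.symm)
  rw [← AddChar.map_zero_eq_one (ZMod.stdAddChar (N := r))] at h1
  refine hne ?_
  rw [sub_dotProduct, ← dotProduct_comp, ← dotProduct_comp, ← sub_dotProduct]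
  exact ZMod.injective_stdAddChar h1

/-- The words of the coset `v + D` lie in the larger code `B`, whose minimum distance gives the
number of bit errors; the minimum distance of `D = (D^⊥)^⊥` gives that of phase errors. -/
lemma correctsErrors_cosetCodeSpace {N : ℕ} {π : Fin N → Fin n}
    {B : Submodule (ZMod r) (Fin n → ZMod r)} {σ : Fin n → Fin N} (hσ : ∀ j, π (σ j) = j)
    (hDB : D ≤ B) (hv : v ∈ B) :
    CorrectsErrors ((minDist B - 1) / 2) ((minDist D - 1) / 2) (cosetCodeSpace D v π) := by
  classical
  -- correctable errors, up to phase errors with the same action on the code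
  let ε : Type := {x : (Fin N → ZMod r) × (Fin n → ZMod r) //
    hammingNorm x.1 ≤ (minDist B - 1) / 2 ∧
      ∃ p : Fin N → ZMod r, hammingNorm p ≤ (minDist D - 1) / 2 ∧ fiberSum π p = x.2}
  let ph : ε → Fin N → ZMod r := fun x => x.2.2.choose
  have hph : ∀ x : ε, hammingNorm (ph x) ≤ (minDist D - 1) / 2 ∧ fiberSum π (ph x) = x.1.2 :=
    fun x => x.2.2.choose_spec
  have hsum : ∀ x : ε, hammingNorm x.1.2 ≤ (minDist D - 1) / 2 := by
    intro x
    rw [← (hph x).2]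
    exact (hammingNorm_fiberSum_le _).trans (hph x).1
  have : Fintype ε := Fintype.ofFinite _
  obtain ⟨M, R, hR, hRA⟩ := exists_recovery (cosetCodeSpace D v π)
    (fun x : ε => pauliMatrix x.1.1 (ph x))
    (fun x => pauliMatrix_conjTranspose_mul_self _ _) (by
      intro x y hxy ψ hψ φ hφ
      rw [pauliMatrix_mulVec, pauliMatrix_mulVec]
      by_cases he : x.1.1 = y.1.1
      · rw [he]
        refine star_pauli_dotProduct_pauli_eq_zero (fun hmem => hxy ?_) hψ hφ
        rw [(hph x).2, (hph y).2] at hmem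
        have h0 : y.1.2 - x.1.2 = 0 := eq_of_sub_eq_sub_of_hammingNorm_le hmem D.zero_mem
          (hsum x) (hsum y) (sub_zero _)
        exact Subtype.ext (Prod.ext he (sub_eq_zero.1 h0).symm)
      · refine Finset.sum_eq_zero fun w _ => ?_
        by_contra hne
        have h1 : ψ (w - x.1.1) ≠ 0 := by
          intro h
          exact hne (by simp [pauli, h])
        have h2 : φ (w - y.1.1) ≠ 0 := by
          intro h
          exact hne (by simp [pauli, h])
        obtain ⟨c, hc, hcw⟩ := hψ.1 _ h1
        obtain ⟨c', hc', hcw'⟩ := hφ.1 _ h2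
        have hdiff : (v + c) ∘ π - (v + c') ∘ π = y.1.1 - x.1.1 := by
          rw [← hcw, ← hcw']
          abel
        have hcc : v + c = v + c' := by
          refine eq_of_sub_eq_sub_of_hammingNorm_le (B.add_mem hv (hDB hc))
            (B.add_mem hv (hDB hc'))
            (e := x.1.1 ∘ σ) (e' := y.1.1 ∘ σ) ?_ ?_ ?_
          · exact (hammingNorm_comp_le (Function.LeftInverse.injective hσ) _).trans x.2.1
          · exact (hammingNorm_comp_le (Function.LeftInverse.injective hσ) _).trans y.2.1
          · funext j
            have := congrFun hdiff (σ j)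
            simpa [hσ j] using this
        rw [hcc, sub_self] at hdiff
        exact he (sub_eq_zero.1 hdiff.symm).symm)
  refine ⟨M, R, hR, fun e p he hp k => ?_⟩
  obtain ⟨c, hc⟩ := hRA k ⟨(e, fiberSum π p), he, p, hp, rfl⟩
  refine ⟨c, fun ψ hψ => ?_⟩
  rw [← hc ψ hψ, pauliMatrix_mulVec]
  congr 1
  exact pauli_eq_of_fiberSum_eq (hph ⟨(e, fiberSum π p), he, p, hp, rfl⟩).2.symm hψ

end CosetCode

/-! ### Correction of misalignment -/

section Misalignment

variable {r : ℕ} [Fact r.Prime]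

lemma applyAt_diagonal {ι κ : Type} [Fintype ι] [DecidableEq ι] {pos : ι → κ}
    (hpos : Function.Injective pos) (d : (ι → ZMod r) → ℂ) (Ψ : QState r κ) (w : κ → ZMod r) :
    applyAt pos (Matrix.diagonal d) Ψ w = d (fun i => w (pos i)) * Ψ w := by
  have hext : Function.extend pos (fun i => w (pos i)) w = w := by
    funext k
    by_cases hk : ∃ i, pos i = k
    · obtain ⟨i, rfl⟩ := hk
      exact hpos.extend_apply _ _ i
    · exact Function.extend_apply' _ _ _ hk
  rw [applyAt, Finset.sum_eq_single (fun i => w (pos i))]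
  · rw [Matrix.diagonal_apply_eq, hext]
  · intro u _ hu
    rw [Matrix.diagonal_apply_ne _ (Ne.symm hu), zero_mul]
  · intro h
    exact absurd (Finset.mem_univ _) h

lemma applyAt_diagonal_eq_self {ι κ : Type} [Fintype ι] [DecidableEq ι] {pos : ι → κ}
    (hpos : Function.Injective pos) {d : (ι → ZMod r) → ℂ} {Ψ : QState r κ}
    (h : ∀ w, Ψ w ≠ 0 → d (fun i => w (pos i)) = 1) :
    applyAt pos (Matrix.diagonal d) Ψ = Ψ := by
  funext w
  rw [applyAt_diagonal hpos]
  by_cases hw : Ψ w = 0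
  · rw [hw, mul_zero]
  · rw [h w hw, one_mul]

variable {n : ℕ} [NeZero n]

/-- A block consists of a word of length `n` that is continued periodically. The `n` letters of a
misaligned window that start `cl` positions after its beginning lie inside a single block, where
they form a cyclic shift of a word in `v + D`, up to bit errors. The measurement is diagonal in the
computational basis: it decodes these letters in the cyclic code `B` and reads off the shift. -/
lemma correctsMisalignment_cosetCodeSpace {D B : Submodule (ZMod r) (Fin n → ZMod r)}
    {v : Fin n → ZMod r} (hDB : D ≤ B) (hv : v ∈ B)
    (hB : ∀ u ∈ B, ∀ t, cyclicShift t u ∈ B)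
    (hshift : ∀ t < n, ∀ t' < n, ∀ c ∈ D, ∀ c' ∈ D,
      cyclicShift t (v + c) = cyclicShift t' (v + c') → t = t')
    {cl cr : ℕ} (hlt : cl + cr < n) (tp : ℕ) :
    CorrectsMisalignment cl cr ((minDist B - 1) / 2) tp
      (cosetCodeSpace D v fun i : Fin (n + cl + cr) => Fin.ofNat n i) := by
  classical
  let mid : Fin n → Fin (n + cl + cr) := fun j => ⟨cl + j, by omega⟩
  -- the words whose middle part is a noisy copy of a word of `v + D` read from position `t` on
  let W : ℕ → (Fin (n + cl + cr) → ZMod r) → Prop := fun t w =>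
    ∃ c ∈ D, ∃ e : Fin n → ZMod r, hammingNorm e ≤ (minDist B - 1) / 2 ∧
      w ∘ mid = cyclicShift t (v + c) + e
  have hW : ∀ t < n, ∀ t' < n, ∀ w, W t w → W t' w → t = t' := by
    rintro t ht t' ht' w ⟨c, hc, e, he, h⟩ ⟨c', hc', e', he', h'⟩
    refine hshift t ht t' ht' c hc c' hc' (eq_of_sub_eq_sub_of_hammingNorm_le
      (hB _ (B.add_mem hv (hDB hc)) t) (hB _ (B.add_mem hv (hDB hc')) t') he he' ?_)
    rw [sub_eq_sub_iff_add_eq_add, ← h, h', add_comm]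
  let d : ℤ → (Fin (n + cl + cr) → ZMod r) → ℂ := fun a w =>
    if (-(cl : ℤ) ≤ a ∧ a ≤ cr) ∧ W (a + cl).toNat w then 1 else 0
  refine ⟨fun a => Matrix.diagonal (d a), fun a => ⟨?_, ?_⟩, fun a a' hne => ?_, ?_⟩
  · change Matrix.diagonal (d a) * Matrix.diagonal (d a) = _
    rw [Matrix.diagonal_mul_diagonal]
    congr 1
    funext w
    simp only [d]
    split_ifs <;> simp
  · change (Matrix.diagonal (d a)).conjTranspose = _
    rw [Matrix.diagonal_conjTranspose]
    congr 1
    funext w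
    simp only [d, Pi.star_apply]
    split_ifs <;> simp
  · rw [Matrix.diagonal_mul_diagonal, ← Matrix.diagonal_zero]
    congr 1
    funext w
    simp only [d]
    split_ifs with h h'
    · have := hW _ (by omega) _ (by omega) w h.2 h'.2
      omega
    all_goals simp
  · intro a ha ha' T b s h hs ψ hψ e p he hp
    have hpos : Function.Injective (windowPos s h) := by
      intro i j hij
      simp only [windowPos, Fin.mk.injEq] at hij
      exact Fin.ext (by omega)
    refine applyAt_diagonal_eq_self hpos fun w hw => if_pos ⟨⟨ha, ha'⟩, ?_⟩
    obtain ⟨t, ht⟩ : ∃ t : ℕ, (a + cl).toNat = t := ⟨_, rfl⟩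
    rw [ht]
    have h0 : ψ b (fun i => (w - e) (blockPos b i)) ≠ 0 :=
      fun h0 => hw (by
        have : streamState ψ (w - e) = 0 := Finset.prod_eq_zero (Finset.mem_univ b) h0
        simp [pauli, this])
    obtain ⟨c, hc, hcw⟩ := (hψ b).1 _ h0
    -- the part of block `b` seen through the middle part of the window
    let τ : Fin n → Fin (n + cl + cr) := fun j => ⟨t + j, by omega⟩
    have hτ : Function.Injective τ := by
      intro i j hij
      simp only [τ, Fin.mk.injEq] at hij
      exact Fin.ext (by omega)
    have hwin : ∀ j, windowPos s h (mid j) = blockPos b (τ j) := by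
      intro j
      apply Fin.ext
      simp only [windowPos, mid, blockPos, τ, finProdFinEquiv_apply_val]
      have hbN : ((b : ℕ) : ℤ) * ((n + cl + cr : ℕ) : ℤ) = (((n + cl + cr) * (b : ℕ) : ℕ) : ℤ) := by
        push_cast
        ring
      rw [hbN] at hs
      omega
    refine ⟨c, hc, (fun i => e (blockPos b i)) ∘ τ, (hammingNorm_comp_le hτ _).trans (he b), ?_⟩
    funext j
    have hj := congrFun hcw (τ j)
    simp only [Pi.sub_apply, Function.comp_apply] at hj
    rw [sub_eq_iff_eq_add] at hj
    rw [Function.comp_apply, hwin, hj]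
    rfl

/-- Synchronizable codes from cyclic codes `⟨f h⟩ ≤ ⟨h⟩` of length `n` such that `⟨f h⟩` contains
its dual and `f` has order `n`: the coset states of `⟨f h⟩` are shifted by the word `h` and
continued periodically. -/
theorem exists_isQuantumSynchronizable {f h : (ZMod r)[X]} (hdvd : f * h ∣ X ^ n - 1)
    (hdeg : h.natDegree < n) (hf : HasPolyOrder f n)
    (hdual : dualCode (cyclicCode n (f * h)) ≤ cyclicCode n (f * h)) {k : ℕ}
    (hk : 2 * Module.finrank (ZMod r) (cyclicCode n (f * h)) = n + k) {cl cr : ℕ}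
    (hlt : cl + cr < n) :
    ∃ Q : Submodule ℂ (QState r (Fin (n + cl + cr))),
      IsQuantumSynchronizable cl cr k ((minDist (cyclicCode n h) - 1) / 2)
        ((minDist (cyclicCode n (f * h)) - 1) / 2) Q := by
  have hv : polyWord n h ∈ cyclicCode n h := by
    rw [mem_cyclicCode, wordPoly_polyWord hdeg]
  have hle : cyclicCode n (f * h) ≤ cyclicCode n h := cyclicCode_anti (dvd_mul_left h f)
  have hσ : ∀ j : Fin n, Fin.ofNat n (Fin.castLE (show n ≤ n + cl + cr by omega) j : ℕ) = j :=
    fun j => Fin.ofNat_val_eq_self j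
  have hπ : Function.Surjective fun i : Fin (n + cl + cr) => Fin.ofNat n i := fun j => ⟨_, hσ j⟩
  refine ⟨cosetCodeSpace (cyclicCode n (f * h)) (polyWord n h) _,
    finrank_cosetCodeSpace hπ hdual hk, ?_, ?_⟩
  · exact correctsMisalignment_cosetCodeSpace hle hv
      (fun u hu t => cyclicShift_mem_cyclicCode ((dvd_mul_left h f).trans hdvd) hu t)
      (fun t ht t' ht' c hc c' hc' heq => eq_of_cyclicShift_eq hdvd hdeg hf ht ht' hc hc' heq)
      hlt _
  · exact correctsErrors_cosetCodeSpace (π := fun i : Fin (n + cl + cr) => Fin.ofNat n i) hσ hle hv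

end Misalignment

/-! ### Cyclic codes from cyclotomic classes of order two -/

lemma exists_isPrimitiveRoot_of_card_eq_one {K : Type*} [Field K] [Finite K] {N : ℕ}
    (h : (Nat.card K : ZMod N) = 1) : ∃ η : K, IsPrimitiveRoot η N := by
  have hK : 1 < Nat.card K := Finite.one_lt_card
  have hdvd : N ∣ Nat.card K - 1 := by
    rw [← ZMod.natCast_eq_zero_iff, Nat.cast_sub hK.le, h, Nat.cast_one, sub_self]
  obtain ⟨a, ha⟩ := hdvd
  obtain ⟨u, hu⟩ := IsCyclic.exists_ofOrder_eq_natCard (α := Kˣ)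
  have hu' : IsPrimitiveRoot (u : K) (Nat.card K - 1) := by
    rw [← Nat.card_units, ← hu, ← orderOf_units]
    exact IsPrimitiveRoot.orderOf _
  exact ⟨(u : K) ^ a, hu'.pow (by omega) (by rw [ha, mul_comm])⟩

theorem theorem4 (q m : ℕ) (hq : q.Prime) (hqm : q = 4 * m + 3)
    (g : ℕ) (hg : orderOf (g : ZMod q) = q - 1) (hg2 : orderOf (g : ZMod (2 * q)) = q - 1)
    (r : ℕ) [Fact r.Prime] (hr : (r : ZMod (2 * q)) ∈ cyclotomicClassD q g 0)
    (l θ : ℕ) (hl : l = orderOf (r : ZMod (2 * q))) (hθ : θ = (q - 1) / (2 * l)) :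
    -- the field with `r ^ l` elements contains a primitive `2q`-th root of unity
    (∃ η : GaloisField r l, IsPrimitiveRoot η (2 * q)) ∧
    ∀ η : GaloisField r l, IsPrimitiveRoot η (2 * q) → ∀ i : Fin 2,
    -- the generator polynomial of `C_{D_i}` has coefficients in the prime field
    ∃ gD : (ZMod r)[X],
      gD.map (algebraMap (ZMod r) (GaloisField r l)) = classPoly η (cyclotomicClassD q g i) ∧
      gD ∣ X ^ (2 * q) - 1 ∧
      dualCode (cyclicCode (2 * q) gD) ≤ cyclicCode (2 * q) gD ∧
      ∀ z : ℕ, z + 2 ≤ θ →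
        -- the chain of augmented codes `C_{D_i} ≤ ⟨g'⟩ < ⟨g''⟩`, with quotient `f = g' / g''`
        ∃ g' g'' f : (ZMod r)[X], g'.Monic ∧ g''.Monic ∧ g' ∣ gD ∧ g' = f * g'' ∧
          dualCode (cyclicCode (2 * q) g') ≤ cyclicCode (2 * q) g' ∧
          cyclicCode (2 * q) gD ≤ cyclicCode (2 * q) g' ∧
          cyclicCode (2 * q) g' < cyclicCode (2 * q) g'' ∧
          cyclicCode (2 * q) g'' < ⊤ ∧
          Module.finrank (ZMod r) (cyclicCode (2 * q) g') = (3 * q + 1) / 2 + z * l ∧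
          HasPolyOrder f (2 * q) ∧
          ∀ cl cr : ℕ, cl + cr < 2 * q →
            ∃ Q : Submodule ℂ (QState r (Fin (2 * q + cl + cr))),
              IsQuantumSynchronizable cl cr (q + 2 * z * l + 1)
                ((minDist (cyclicCode (2 * q) g'') - 1) / 2)
                ((minDist (cyclicCode (2 * q) g') - 1) / 2) Q := by
  have : NeZero (2 * q) := ⟨by omega⟩
  have hodd : Odd q := ⟨2 * m + 1, by omega⟩
  have hq1 : 1 < q := hq.one_lt
  have hγ : (g : ZMod (2 * q)) ^ (q - 1) = 1 := hg2 ▸ pow_orderOf_eq_one _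
  have hγu : IsUnit (g : ZMod (2 * q)) := IsUnit.of_pow_eq_one hγ (by omega)
  obtain ⟨a, -, ha⟩ := Finset.mem_image.1 hr
  rw [add_zero] at ha
  have hρu : IsUnit (r : ZMod (2 * q)) := ha ▸ hγu.pow _
  have hρl : (r : ZMod (2 * q)) ^ l = 1 := hl ▸ pow_orderOf_eq_one _
  -- `r` is a square, so its order divides `(q - 1) / 2 = 2m + 1`
  obtain ⟨k, hk⟩ : l ∣ 2 * m + 1 := by
    rw [hl]
    refine orderOf_dvd_of_pow_eq_one ?_
    rw [← ha, ← pow_mul, show 2 * a * (2 * m + 1) = (q - 1) * a by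
      rw [hqm, show 4 * m + 3 - 1 = 2 * (2 * m + 1) by omega]; ring, pow_mul, hγ, one_pow]
  have hl0 : 0 < l := Nat.pos_of_ne_zero (by rintro rfl; omega)
  have hθk : θ = k := by
    rw [hθ, show q - 1 = 2 * l * k by rw [mul_assoc, ← hk]; omega]
    exact Nat.mul_div_cancel_left _ (by omega)
  subst hθk
  have hθl : θ * l = 2 * m + 1 := by rw [hk, mul_comm]
  have hord : orderOf (g : ZMod (2 * q)) = 2 * θ * l := by
    rw [hg2, mul_assoc, hθl]
    omega
  refine ⟨exists_isPrimitiveRoot_of_card_eq_one ?_, fun η hη i => ?_⟩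
  · rw [GaloisField.card r l hl0.ne', Nat.cast_pow, hρl]
  have hcardD : (cyclotomicClassD q g i).card < 2 * q := by
    refine (Finset.card_image_le).trans_lt ?_
    rw [Finset.card_range]
    omega
  have hneg : ∀ j ∈ cyclotomicClassD q g i, -j ∉ cyclotomicClassD q g i :=
    fun j hj => neg_notMem_cyclotomicClassD hqm hγu hγ hj
  obtain ⟨gD, hgD⟩ := exists_map_eq_classPoly (r := r) hη hρu (S := cyclotomicClassD q g i)
    fun j hj => by
      rw [← ha]
      exact mul_mem_cyclotomicClassD hγ hodd hq1 hj
  refine ⟨gD, hgD, ?_, dualCode_le_cyclicCode hη hgD hcardD hneg, fun z hz => ?_⟩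
  · rw [← map_dvd_map' (algebraMap (ZMod r) (GaloisField r l)), hgD]
    simpa using classPoly_dvd_X_pow_sub_one hη _
  obtain ⟨T, rfl⟩ : ∃ T, θ = T + 1 + z := ⟨θ - z - 1, by omega⟩
  have hT : 0 < T := by omega
  -- `g'` and `g''` have the zeros in `T + 1` and `T` orbits under `r`, and `f` those in one orbit
  set γ : ZMod (2 * q) := (g : ZMod (2 * q)) with hγdef
  set ρ : ZMod (2 * q) := (r : ZMod (2 * q)) with hρdef
  obtain ⟨f, hf⟩ := exists_map_eq_classPoly (r := r) hη hρu (S := powCoset ρ γ l i T)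
    fun j hj => mul_mem_powCoset hρl hl0 hj
  obtain ⟨h, hh⟩ := exists_map_eq_classPoly (r := r) hη hρu (S := powCosets ρ γ l i T)
    fun j hj => mul_mem_powCosets hρl hl0 hj
  have hsub : powCosets ρ γ l i (T + 1) ⊆ cyclotomicClassD q g i := by
    rw [← ha]
    exact powCosets_subset_cyclotomicClassD l (T + 1) hγ hodd hq1
  have hdisj : Disjoint (powCoset ρ γ l i T) (powCosets ρ γ l i T) := by
    rw [powCosets, Finset.disjoint_biUnion_right]
    intro t ht
    have := Finset.mem_range.1 ht
    exact disjoint_powCoset hρl hγu hord hl0 (by omega) (by omega) (by omega)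
  have hfh : (f * h).map (algebraMap (ZMod r) (GaloisField r l)) =
      classPoly η (powCosets ρ γ l i (T + 1)) := by
    rw [Polynomial.map_mul, hf, hh, powCosets_succ]
    exact (Finset.prod_union hdisj).symm
  have hdvdD : f * h ∣ gD := by
    rw [← map_dvd_map' (algebraMap (ZMod r) (GaloisField r l)), hgD, hfh]
    exact Finset.prod_dvd_prod_of_subset _ _ _ hsub
  have hdvd : f * h ∣ X ^ (2 * q) - 1 := by
    rw [← map_dvd_map' (algebraMap (ZMod r) (GaloisField r l)), hfh]
    simpa using classPoly_dvd_X_pow_sub_one hη _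
  have hfhmon : (f * h).Monic := by
    rw [← monic_map_iff (f := algebraMap (ZMod r) (GaloisField r l)), hfh]
    exact monic_classPoly _ _
  have hhmon : h.Monic := by
    rw [← monic_map_iff (f := algebraMap (ZMod r) (GaloisField r l)), hh]
    exact monic_classPoly _ _
  have hfhdeg : (f * h).natDegree = (T + 1) * l := by
    rw [← natDegree_map (algebraMap (ZMod r) (GaloisField r l)), hfh, natDegree_classPoly,
      card_powCosets hγu hρu hl.symm hord hl0 (by omega)]
  have hhdeg : h.natDegree = T * l := by
    rw [← natDegree_map (algebraMap (ZMod r) (GaloisField r l)), hh, natDegree_classPoly,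
      card_powCosets hγu hρu hl.symm hord hl0 (by omega)]
  have hTl : (T + 1) * l = T * l + l := by ring
  have hTzl : T * l + l + z * l = 2 * m + 1 := by rw [← hθl]; ring
  have hTl0 : 0 < T * l := Nat.mul_pos hT hl0
  have hrank' := finrank_cyclicCode (n := 2 * q) hfhmon (by omega)
  have hrank'' := finrank_cyclicCode (n := 2 * q) hhmon (by omega)
  have hdual : dualCode (cyclicCode (2 * q) (f * h)) ≤ cyclicCode (2 * q) (f * h) :=
    dualCode_le_cyclicCode hη hfh ((Finset.card_le_card hsub).trans_lt hcardD)
      fun j hj hj' => hneg j (hsub hj) (hsub hj')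
  have hforder : HasPolyOrder f (2 * q) := by
    refine hasPolyOrder_of_isUnit_mem hη hf (j := ρ ^ 0 * γ ^ (2 * T + i)) ?_
      ((hρu.pow _).mul (hγu.pow _))
    exact Finset.mem_image_of_mem _ (Finset.mem_range.2 hl0)
  refine ⟨f * h, h, f, hfhmon, hhmon, hdvdD, rfl, hdual, cyclicCode_anti hdvdD, ?_, ?_, ?_,
    hforder, fun cl cr hlt => ?_⟩
  · refine lt_of_le_of_ne (cyclicCode_anti (dvd_mul_left h f)) fun heq => ?_
    rw [heq] at hrank'
    omega
  · refine lt_top_iff_ne_top.2 fun heq => ?_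
    rw [heq, finrank_top, Module.finrank_fin_fun] at hrank''
    omega
  · omega
  · refine exists_isQuantumSynchronizable hdvd (by omega) hforder hdual ?_ hlt
    have h2 : 2 * z * l = 2 * (z * l) := by ring
    omega
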